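/- **Theorem 5.9.** Let $X$ be a real vector lattice and let $\tau$ be a Hausdorff locally solid topology on $X$, i.e. a Hausdorff linear topology with a base at zero consisting of solid sets. A net $(x_\alpha)_{\alpha\in A}$ in $X$ is *order convergent* to $x$ ($x_\alpha\xrightarrow{o}x$) if there is a net $(y_\beta)_{\beta\in B}$, possibly over a different index set, with $y_\beta\downarrow 0$ such that for every $\beta\in B$ there is $\alpha_0\in A$ with $|x_\alpha-x|\le y_\beta$ for all $\alpha\ge\alpha_0$; it is *$uo$-convergent* to $x$ ($x_\alpha\xrightarrow{uo}x$) if $|x_\alpha-x|\wedge u\xrightarrow{o}0$ for every $u\in X_+$. Let $u\tau$ be the topology on $X$ in which the sets $\{y\in X: |y-x|\wedge u\in U\}$, with $u\in X_+$ and $U$ a $\tau$-neighbourhood of $0$, generate the neighbourhoods of $x$; thus $x_\alpha\xrightarrow{u\tau}x$ if and only if $|x_\alpha-x|\wedge u\xrightarrow{\tau}0$ for every $u\in X_+$. The following are equivalent: 1. $\tau$ is *$uo$-Lebesgue*: for every net $(x_\alpha)$ in $X$, $x_\alpha\xrightarrow{uo}0$ implies $x_\alpha\xrightarrow{\tau}0$;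 2. $\tau$ is *Lebesgue*, i.e. for every net $(x_\alpha)$ in $X$, $x_\alpha\xrightarrow{o}0$ implies $x_\alpha\xrightarrow{\tau}0$, and *unbounded*, i.e. $\tau=u\tau$. -/

import Mathlib

open Set Filter Topology

universe u v

/-- Order convergence of a net `x` indexed by `A` to `l`: there is a net `y ↓ 0`, possibly over a
different directed set `B`, such that every `y b` eventually dominates `|x a - l|`.  Only the range
of `y` matters, so index sets in the universe of `X` are enough. -/
def OrderConverges {X : Type u} [AddCommGroup X] [Lattice X] {A : Type v} [Preorder A]
    (x : A → X) (l : X) : Prop :=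
  ∃ (B : Type u) (_ : Preorder B) (_ : IsDirectedOrder B) (_ : Nonempty B) (y : B → X),
    Antitone y ∧ IsGLB (range y) 0 ∧ ∀ b, ∃ a₀, ∀ a, a₀ ≤ a → |x a - l| ≤ y b

/-- Unbounded order convergence: `|x a - l| ⊓ u` order converges to `0` for all `u ≥ 0`. -/
def UOConverges {X : Type u} [AddCommGroup X] [Lattice X] {A : Type v} [Preorder A]
    (x : A → X) (l : X) : Prop :=
  ∀ u : X, 0 ≤ u → OrderConverges (fun a => |x a - l| ⊓ u) 0

/-- A locally solid topology on a vector lattice: a linear topology with a base at zero consisting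
of solid sets. -/
structure IsLocallySolid {X : Type*} [AddCommGroup X] [Lattice X] [Module ℝ X]
    (τ : TopologicalSpace X) : Prop where
  continuous_add : Continuous fun p : X × X => p.1 + p.2
  continuous_smul : Continuous fun p : ℝ × X => p.1 • p.2
  solid_base : ∀ U ∈ 𝓝 (0 : X), ∃ V ∈ 𝓝 (0 : X), LatticeOrderedAddCommGroup.IsSolid V ∧ V ⊆ U

/-- Lebesgue (order continuous) topologies: order null nets are `τ`-null.  Every net has the same
tail filter as some net indexed in the universe of `X`, so the universe is no restriction. -/
def IsLebesgue {X : Type u} [AddCommGroup X] [Lattice X] (τ : TopologicalSpace X) : Prop :=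
  ∀ (A : Type u) [Preorder A] [IsDirectedOrder A] [Nonempty A] (x : A → X),
    OrderConverges x 0 → Tendsto x atTop (𝓝 0)

/-- `uo`-Lebesgue (unbounded order continuous) topologies: `uo`-null nets are `τ`-null. -/
def IsUOLebesgue {X : Type u} [AddCommGroup X] [Lattice X] (τ : TopologicalSpace X) : Prop :=
  ∀ (A : Type u) [Preorder A] [IsDirectedOrder A] [Nonempty A] (x : A → X),
    UOConverges x 0 → Tendsto x atTop (𝓝 0)

/-- The topology `uτ`, whose neighbourhoods of `x` are generated by the sets
`{y | |y - x| ⊓ u ∈ U}` for `u ≥ 0` and `U` a `τ`-neighbourhood of `0`. -/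
@[reducible] def unboundedTopology {X : Type*} [AddCommGroup X] [Lattice X] (τ : TopologicalSpace X) :
    TopologicalSpace X :=
  TopologicalSpace.mkOfNhds fun x =>
    ⨅ u : {u : X // 0 ≤ u}, comap (fun y => |y - x| ⊓ (u : X)) (𝓝 0)

/-- `τ` is unbounded if `τ = uτ`. -/
def IsUnboundedTopology {X : Type*} [AddCommGroup X] [Lattice X] (τ : TopologicalSpace X) : Prop :=
  τ = unboundedTopology τ

/-- For a locally solid `τ`, the sets above are the neighbourhoods in `uτ`. -/
theorem nhds_unboundedTopology {X : Type*} [AddCommGroup X] [Lattice X] [IsOrderedAddMonoid X]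
    [Module ℝ X] (τ : TopologicalSpace X) (hτ : IsLocallySolid τ) (x : X) :
    @nhds X (unboundedTopology τ) x =
      ⨅ u : {u : X // 0 ≤ u}, comap (fun y => |y - x| ⊓ (u : X)) (𝓝 0) := by
  apply TopologicalSpace.nhds_mkOfNhds
  · intro a
    refine le_iInf fun u => ?_
    rw [← map_le_iff_le_comap, map_pure]
    simpa [u.2] using pure_le_nhds (0 : X)
  · intro a s hs
    have key : ∀ u : {u : X // 0 ≤ u}, ∀ V ∈ 𝓝 (0 : X), ∃ W ∈ 𝓝 (0 : X), ∀ y z : X,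
        |y - a| ⊓ (u : X) ∈ W → |z - y| ⊓ (u : X) ∈ W → |z - a| ⊓ (u : X) ∈ V := by
      intro u V hV
      obtain ⟨V', hV', hsol, hsub⟩ := hτ.solid_base V hV
      have h0 : Tendsto (fun p : X × X => p.1 + p.2) (𝓝 0 ×ˢ 𝓝 0) (𝓝 0) := by
        have := hτ.continuous_add.tendsto (0, 0)
        simpa [nhds_prod_eq] using this
      obtain ⟨W, hW, hWV⟩ := mem_prod_same_iff.1 (h0 hV')
      refine ⟨W, hW, fun y z hy hz => hsub (hsol (hWV (mk_mem_prod hy hz)) ?_)⟩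
      have hu := u.2
      rw [abs_of_nonneg (le_inf (abs_nonneg _) hu),
        abs_of_nonneg (add_nonneg (le_inf (abs_nonneg _) hu) (le_inf (abs_nonneg _) hu))]
      have h1 : |z - a| ≤ |y - a| + |z - y| := by
        have := abs_add_le (y - a) (z - y)
        simpa using this
      rw [inf_add, add_inf, add_inf]
      refine le_inf (le_inf (inf_le_left.trans h1) (inf_le_right.trans ?_))
        (le_inf (inf_le_right.trans ?_) (inf_le_right.trans ?_))
      · exact le_add_of_nonneg_left (abs_nonneg _)
      · exact le_add_of_nonneg_right (abs_nonneg _)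
      · exact le_add_of_nonneg_right hu
    have main : ∀ u : {u : X // 0 ≤ u}, ∀ T ∈ comap (fun y => |y - a| ⊓ (u : X)) (𝓝 0),
        ∀ᶠ y in ⨅ u : {u : X // 0 ≤ u}, comap (fun y => |y - a| ⊓ (u : X)) (𝓝 0),
          T ∈ ⨅ u : {u : X // 0 ≤ u}, comap (fun z => |z - y| ⊓ (u : X)) (𝓝 0) := by
      rintro u T ⟨V, hV, hVT⟩
      obtain ⟨W, hW, h⟩ := key u V hV
      filter_upwards [mem_iInf_of_mem u (preimage_mem_comap hW)] with y hy
      filter_upwards [mem_iInf_of_mem u (preimage_mem_comap hW)] with z hz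
      exact hVT (h y z hy hz)
    obtain ⟨I, hI, V, hV, -, rfl, -⟩ := mem_iInf'.1 hs
    filter_upwards [(eventually_all_finite hI).2 fun i _ => main i (V i) (hV i)] with y hy
    exact (biInter_mem hI).2 hy

/-- Convergence in `uτ` is unbounded `τ`-convergence. -/
theorem tendsto_unboundedTopology_iff {X : Type*} [AddCommGroup X] [Lattice X]
    [IsOrderedAddMonoid X] [Module ℝ X] (τ : TopologicalSpace X) (hτ : IsLocallySolid τ)
    {A : Type*} (f : Filter A) (x : A → X) (l : X) :
    Tendsto x f (@nhds X (unboundedTopology τ) l) ↔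
      ∀ u : X, 0 ≤ u → Tendsto (fun a => |x a - l| ⊓ u) f (𝓝 0) := by
  rw [nhds_unboundedTopology τ hτ, tendsto_iInf]
  simp only [tendsto_comap_iff, Subtype.forall]
  rfl

/-! If `τ` is Lebesgue and unbounded, a `uo`-null net is `uτ`-null by definition, hence `τ`-null.
Conversely, order null nets are `uo`-null, so the content is that a `uo`-Lebesgue `τ` is coarser
than `uτ`. If that fails at `U`, take solid `V n` with `V (n+1) + V (n+1) ⊆ V n` and `V 0 ⊆ U`; then
`N = ⋂ V n` is an ideal. Density of `N` plus its disjoint complement (`IsLebesgue.exists_add_close`)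
yields positive `q n` disjoint from `N`, outside `V 1`, and almost disjoint from all earlier terms.
Such a sequence is `uo`-null (`IsLebesgue.uoConverges_of_almost_disjoint`), contradicting `q n ∉ V
1`. Suprema of sequences need not exist, so upper bounds close to finite suprema replace them; the
Archimedean property eliminates positive lower bounds. -/

section LocallySolid

variable {X : Type u} [AddCommGroup X] [Lattice X] [IsOrderedAddMonoid X]

/-! ### Order null nets from directed sets -/

/-- Indexed by itself in reverse order, `D` is a net decreasing to zero. -/
theorem IsLebesgue.exists_mem_of_isGLB {τ : TopologicalSpace X} (h : IsLebesgue τ) {D : Set X}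
    (hne : D.Nonempty) (hdir : ∀ a ∈ D, ∀ b ∈ D, ∃ c ∈ D, c ≤ a ∧ c ≤ b)
    (hglb : IsGLB D 0) {V : Set X} (hV : V ∈ 𝓝 (0 : X)) :
    ∃ d ∈ D, d ∈ V := by
  have hd : IsDirectedOrder (↥D)ᵒᵈ := ⟨fun a b => by
    obtain ⟨c, hc, h1, h2⟩ := hdir _ (OrderDual.ofDual a).2 _ (OrderDual.ofDual b).2
    exact ⟨OrderDual.toDual ⟨c, hc⟩, h1, h2⟩⟩
  have hn : Nonempty (↥D)ᵒᵈ := let ⟨d, hd⟩ := hne; ⟨OrderDual.toDual ⟨d, hd⟩⟩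
  let f : (↥D)ᵒᵈ → X := fun a => (OrderDual.ofDual a : ↥D)
  have hf : Antitone f := fun a b hab => hab
  have hr : range f = D := by
    ext d
    exact ⟨fun ⟨a, ha⟩ => ha ▸ (OrderDual.ofDual a).2, fun hd => ⟨OrderDual.toDual ⟨d, hd⟩, rfl⟩⟩
  have key : OrderConverges f 0 := by
    refine ⟨(↥D)ᵒᵈ, inferInstance, hd, hn, f, hf, by rwa [hr], fun b => ⟨b, fun a hab => ?_⟩⟩
    rw [sub_zero, abs_of_nonneg (hglb.1 (OrderDual.ofDual a).2)]
    exact hf hab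
  obtain ⟨a, ha⟩ := ((h _ f key).eventually hV).exists
  exact ⟨f a, (OrderDual.ofDual a).2, ha⟩

/-- The eventual bounds are closed under `⊓`, so in reverse order they form the dominating net. -/
theorem OrderConverges.of_eventual_bounds {A : Type v} [Preorder A] [IsDirectedOrder A]
    [Nonempty A] {x : A → X}
    (hne : ∃ y, ∃ a₀, ∀ a, a₀ ≤ a → |x a| ≤ y)
    (hz : ∀ z, 0 ≤ z → (∀ y, (∃ a₀, ∀ a, a₀ ≤ a → |x a| ≤ y) → z ≤ y) → z = 0) :
    OrderConverges x 0 := by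
  let Y : Set X := {y | ∃ a₀, ∀ a, a₀ ≤ a → |x a| ≤ y}
  have h0 : (0 : X) ∈ lowerBounds Y := by
    rintro y ⟨a₀, h⟩
    exact (abs_nonneg _).trans (h a₀ le_rfl)
  have hd : IsDirectedOrder (↥Y)ᵒᵈ := ⟨fun a b => by
    obtain ⟨a₁, h1⟩ := (OrderDual.ofDual a).2
    obtain ⟨a₂, h2⟩ := (OrderDual.ofDual b).2
    obtain ⟨a₃, h13, h23⟩ := exists_ge_ge a₁ a₂
    exact ⟨OrderDual.toDual ⟨(OrderDual.ofDual a : Y) ⊓ (OrderDual.ofDual b : Y),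
      a₃, fun c hc => le_inf (h1 c (h13.trans hc)) (h2 c (h23.trans hc))⟩,
      (inf_le_left : _ ⊓ _ ≤ ((OrderDual.ofDual a : Y) : X)),
      (inf_le_right : _ ⊓ _ ≤ ((OrderDual.ofDual b : Y) : X))⟩⟩
  have hn : Nonempty (↥Y)ᵒᵈ := let ⟨d, hd⟩ := hne; ⟨OrderDual.toDual ⟨d, hd⟩⟩
  let f : (↥Y)ᵒᵈ → X := fun a => (OrderDual.ofDual a : ↥Y)
  have hr : range f = Y := by
    ext d
    exact ⟨fun ⟨a, ha⟩ => ha ▸ (OrderDual.ofDual a).2, fun hd => ⟨OrderDual.toDual ⟨d, hd⟩, rfl⟩⟩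
  refine ⟨(↥Y)ᵒᵈ, inferInstance, hd, hn, f, fun a b hab => hab, ?_, fun b => ?_⟩
  · rw [hr]
    refine ⟨h0, fun z hzY => ?_⟩
    have h1 : z ⊔ 0 = 0 := hz _ le_sup_right fun y hy => sup_le (hzY hy) (h0 hy)
    exact le_sup_left.trans h1.le
  · obtain ⟨a₀, h⟩ := (OrderDual.ofDual b).2
    exact ⟨a₀, fun a ha => by rw [sub_zero]; exact h a ha⟩

theorem UOConverges.of_orderConverges_zero {A : Type v} [Preorder A] {x : A → X}
    (h : OrderConverges x 0) : UOConverges x 0 := by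
  obtain ⟨B, i1, i2, i3, y, hy, hglb, hb⟩ := h
  refine fun u hu => ⟨B, i1, i2, i3, y, hy, hglb, fun b => ?_⟩
  obtain ⟨a₀, ha⟩ := hb b
  refine ⟨a₀, fun a h => ?_⟩
  rw [sub_zero, abs_of_nonneg (le_inf (abs_nonneg _) hu)]
  exact inf_le_left.trans (ha a h)

/-! ### Disjointness, solid sets and finite sums -/

theorem add_inf_le_inf_add_inf {a b c : X} (ha : 0 ≤ a) (hb : 0 ≤ b) (hc : 0 ≤ c) :
    (a + b) ⊓ c ≤ a ⊓ c + b ⊓ c := by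
  rw [inf_add, add_inf, add_inf]
  exact le_inf (le_inf inf_le_left (inf_le_right.trans (le_add_of_nonneg_left ha)))
    (le_inf (inf_le_right.trans (le_add_of_nonneg_right hb))
      (inf_le_right.trans (le_add_of_nonneg_right hc)))

theorem add_le_of_inf_eq_zero {a b c : X} (h : a ⊓ b = 0) (ha : a ≤ c) (hb : b ≤ c) :
    a + b ≤ c := by
  rw [← inf_add_sup a b, h, zero_add]
  exact sup_le ha hb

omit [IsOrderedAddMonoid X] in
theorem eq_zero_of_le_inf_eq_zero {a b c d : X} (h : a ⊓ b = 0) (hc : 0 ≤ c) (hd : 0 ≤ d)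
    (hca : c ≤ a) (hdb : d ≤ b) : c ⊓ d = 0 :=
  le_antisymm ((inf_le_inf hca hdb).trans h.le) (le_inf hc hd)

theorem add_inf_eq_zero {a b c : X} (ha : 0 ≤ a) (hb : 0 ≤ b) (hc : 0 ≤ c) (hac : a ⊓ c = 0)
    (hbc : b ⊓ c = 0) : (a + b) ⊓ c = 0 := by
  refine le_antisymm ((add_inf_le_inf_add_inf ha hb hc).trans ?_) (le_inf (add_nonneg ha hb) hc)
  rw [hac, hbc, add_zero]

theorem nsmul_inf_eq_zero {a c : X} (ha : 0 ≤ a) (hc : 0 ≤ c) (hac : a ⊓ c = 0) (n : ℕ) :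
    (n • a) ⊓ c = 0 := by
  induction n with
  | zero => simpa using hc
  | succ n ih =>
    rw [succ_nsmul]
    exact add_inf_eq_zero (nsmul_nonneg ha n) ha hc ih hac

theorem LatticeOrderedAddCommGroup.IsSolid.mem_of_le {V : Set X}
    (hV : LatticeOrderedAddCommGroup.IsSolid V) {x y : X} (hx : x ∈ V) (hy : 0 ≤ y)
    (hyx : y ≤ x) : y ∈ V :=
  hV hx (by rwa [abs_of_nonneg hy, abs_of_nonneg (hy.trans hyx)])

theorem LatticeOrderedAddCommGroup.IsSolid.abs_mem_iff {V : Set X}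
    (hV : LatticeOrderedAddCommGroup.IsSolid V) {x : X} : |x| ∈ V ↔ x ∈ V :=
  ⟨fun h => hV h (abs_abs x).ge, fun h => hV h (abs_abs x).le⟩

theorem partialSups_inf_le_sum {f : ℕ → X} (hf : ∀ n, 0 ≤ f n) {c : X} (hc : 0 ≤ c) (m : ℕ) :
    partialSups f m ⊓ c ≤ ∑ i ∈ Finset.range (m + 1), f i ⊓ c := by
  induction m with
  | zero => simp
  | succ m ih =>
    have h0 : 0 ≤ partialSups f m := (hf m).trans (le_partialSups f m)
    rw [partialSups_add_one, Finset.sum_range_succ]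
    refine (inf_le_inf_right c ?_).trans ((add_inf_le_inf_add_inf h0 (hf _) hc).trans
      (add_le_add_left ih _))
    exact sup_le (le_add_of_nonneg_right (hf _)) (le_add_of_nonneg_left h0)

omit [Lattice X] [IsOrderedAddMonoid X] in
theorem sum_range_mem_of_add_mem {V : ℕ → Set X} (h0 : ∀ n, (0 : X) ∈ V n)
    (hadd : ∀ n, ∀ a ∈ V (n + 1), ∀ b ∈ V (n + 1), a + b ∈ V n) (m : ℕ) :
    ∀ (N : ℕ) (v : ℕ → X), (∀ i, v i ∈ V (N + 1 + i)) → ∑ i ∈ Finset.range m, v i ∈ V N := by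
  induction m with
  | zero => exact fun N v _ => by simpa using h0 N
  | succ m ih =>
    intro N v hv
    -- Splitting off the first term leaves a tail that starts one level deeper.
    rw [Finset.sum_range_succ']
    refine hadd N _ (ih (N + 1) (fun i => v (i + 1)) fun i => ?_) _ (hv 0)
    have := hv (i + 1)
    rwa [show N + 1 + (i + 1) = N + 1 + 1 + i by omega] at this

/-! ### Archimedean property and approximation in Lebesgue topologies -/

variable [Module ℝ X] [IsOrderedModule ℝ X] {τ : TopologicalSpace X}

/-- Here `z` lies below multiples of `y` that tend to zero, hence in every solid neighbourhood. -/
theorem IsLocallySolid.eq_zero_of_forall_nsmul_le (hτ : IsLocallySolid τ) [T2Space X] {z y : X}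
    (hz : 0 ≤ z) (h : ∀ n : ℕ, n • z ≤ y) : z = 0 := by
  by_contra hne
  obtain ⟨V, hV, hsol, hsub⟩ := hτ.solid_base _ (isOpen_compl_singleton.mem_nhds (Ne.symm hne))
  have ht : Tendsto (fun n : ℕ => ((n : ℝ) + 1)⁻¹ • y) atTop (𝓝 0) := by
    have h1 : Tendsto (fun r : ℝ => r • y) (𝓝 0) (𝓝 ((0 : ℝ) • y)) :=
      (hτ.continuous_smul.comp (by fun_prop : Continuous fun r : ℝ => (r, y))).tendsto 0
    rw [zero_smul] at h1
    refine h1.comp ?_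
    simpa [one_div] using tendsto_one_div_add_atTop_nhds_zero_nat (𝕜 := ℝ)
  obtain ⟨n, hn⟩ := (ht.eventually hV).exists
  refine hsub (hsol.mem_of_le hn hz ?_) rfl
  have hp : (0 : ℝ) < (n : ℝ) + 1 := by positivity
  have h2 := smul_le_smul_of_nonneg_left (h (n + 1)) (inv_nonneg.2 hp.le)
  rwa [← Nat.cast_smul_eq_nsmul ℝ, smul_smul, Nat.cast_add, Nat.cast_one, inv_mul_cancel₀ hp.ne',
    one_smul] at h2


omit [IsOrderedAddMonoid X] [IsOrderedModule ℝ X] in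
theorem IsLocallySolid.exists_seq (hτ : IsLocallySolid τ) {U : Set X} (hU : U ∈ 𝓝 (0 : X)) :
    ∃ V : ℕ → Set X, (∀ n, V n ∈ 𝓝 (0 : X)) ∧
      (∀ n, LatticeOrderedAddCommGroup.IsSolid (V n)) ∧
      (∀ n, ∀ a ∈ V (n + 1), ∀ b ∈ V (n + 1), a + b ∈ V n) ∧ V 0 ⊆ U := by
  have step : ∀ U : {U : Set X // U ∈ 𝓝 (0 : X)}, ∃ W : {U : Set X // U ∈ 𝓝 (0 : X)},
      LatticeOrderedAddCommGroup.IsSolid (W : Set X) ∧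
        ∀ a ∈ (W : Set X), ∀ b ∈ (W : Set X), a + b ∈ (U : Set X) := by
    rintro ⟨U, hU⟩
    have h0 : Tendsto (fun p : X × X => p.1 + p.2) (𝓝 0 ×ˢ 𝓝 0) (𝓝 0) := by
      have := hτ.continuous_add.tendsto (0, 0)
      simpa [nhds_prod_eq] using this
    obtain ⟨W, hW, hWU⟩ := mem_prod_same_iff.1 (h0 hU)
    obtain ⟨V, hV, hsol, hVW⟩ := hτ.solid_base W hW
    exact ⟨⟨V, hV⟩, hsol, fun a ha b hb => hWU (mk_mem_prod (hVW ha) (hVW hb))⟩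
  choose f hsol hadd using step
  -- With `n + 1` iterations, `V 0` is already a value of `f`, hence solid.
  let V : ℕ → {U : Set X // U ∈ 𝓝 (0 : X)} := fun n => f^[n + 1] ⟨U, hU⟩
  have hV : ∀ n, V (n + 1) = f (V n) := fun n => Function.iterate_succ_apply' f (n + 1) _
  refine ⟨fun n => V n, fun n => (V n).2, fun n => ?_, fun n => ?_, fun x hx => ?_⟩
  · cases n with
    | zero => exact hsol _
    | succ n => simpa only [hV] using hsol (V n)
  · simpa only [hV] using hadd (V n)
  · simpa using hadd ⟨U, hU⟩ x hx 0 (mem_of_mem_nhds (f ⟨U, hU⟩).2)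

/-- In a Hausdorff Lebesgue topology, the sum of an ideal and its disjoint complement is dense. -/
theorem IsLebesgue.exists_add_close (h : IsLebesgue τ) (hτ : IsLocallySolid τ) [T2Space X]
    {N : Set X} (hN : LatticeOrderedAddCommGroup.IsSolid N) (h0 : (0 : X) ∈ N)
    (hadd : ∀ a ∈ N, ∀ b ∈ N, a + b ∈ N) {x : X} (hx : 0 ≤ x) {V : Set X} (hV : V ∈ 𝓝 (0 : X)) :
    ∃ p q : X, p ∈ N ∧ 0 ≤ p ∧ 0 ≤ q ∧ (∀ c ∈ N, 0 ≤ c → q ⊓ c = 0) ∧ p + q ≤ x ∧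
      x - (p + q) ∈ V := by
  let D : Set X := {d | ∃ p q : X, p ∈ N ∧ 0 ≤ p ∧ 0 ≤ q ∧ (∀ c ∈ N, 0 ≤ c → q ⊓ c = 0) ∧
    p + q ≤ x ∧ x - (p + q) = d}
  have hD0 : ∀ d ∈ D, 0 ≤ d := by
    rintro d ⟨p, q, -, -, -, -, hpq, rfl⟩
    exact sub_nonneg.2 hpq
  suffices hs : ∃ d ∈ D, d ∈ V by
    obtain ⟨d, ⟨p, q, h1, h2, h3, h4, h5, rfl⟩, hd⟩ := hs
    exact ⟨p, q, h1, h2, h3, h4, h5, hd⟩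
  refine h.exists_mem_of_isGLB ?_ ?_ ⟨hD0, fun z hz => ?_⟩ hV
  · exact ⟨_, 0, 0, h0, le_rfl, le_rfl, fun c _ hc => inf_eq_left.2 hc, by simpa using hx, rfl⟩
  · rintro _ ⟨p, q, hp, hp0, hq0, hq, hpq, rfl⟩ _ ⟨p', q', hp', hp0', hq0', hq', hpq', rfl⟩
    have hP0 : 0 ≤ p ⊔ p' := hp0.trans le_sup_left
    have hQ0 : 0 ≤ q ⊔ q' := hq0.trans le_sup_left
    have hP : p ⊔ p' ∈ N := hN.mem_of_le (hadd p hp p' hp') hP0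
      (sup_le (le_add_of_nonneg_right hp0') (le_add_of_nonneg_left hp0))
    have hQ : ∀ c ∈ N, 0 ≤ c → (q ⊔ q') ⊓ c = 0 := fun c hc hc0 =>
      eq_zero_of_le_inf_eq_zero
        (add_inf_eq_zero hq0 hq0' hc0 (hq c hc hc0) (hq' c hc hc0)) hQ0 hc0
        (sup_le (le_add_of_nonneg_right hq0') (le_add_of_nonneg_left hq0)) le_rfl
    refine ⟨_, ⟨p ⊔ p', q ⊔ q', hP, hP0, hQ0, hQ, ?_, rfl⟩, ?_, ?_⟩
    · refine add_le_of_inf_eq_zero (by rw [inf_comm]; exact hQ _ hP hP0) (sup_le ?_ ?_)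
        (sup_le ?_ ?_)
      · exact (le_add_of_nonneg_right hq0).trans hpq
      · exact (le_add_of_nonneg_right hq0').trans hpq'
      · exact (le_add_of_nonneg_left hp0).trans hpq
      · exact (le_add_of_nonneg_left hp0').trans hpq'
    · exact sub_le_sub_left (add_le_add le_sup_left le_sup_left) _
    · exact sub_le_sub_left (add_le_add le_sup_right le_sup_right) _
  · have hw : z ⊔ 0 ∈ lowerBounds D := fun d hd => sup_le (hz hd) (hD0 d hd)
    have hw0 : 0 ≤ z ⊔ 0 := le_sup_right
    refine le_sup_left.trans (le_of_eq (?_ : z ⊔ 0 = 0))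
    generalize z ⊔ 0 = w at hw hw0
    -- A lower bound `w` of the gaps is disjoint from `N`: otherwise `w ⊓ c` could be added to `p`
    -- indefinitely below `x`. Then `w` itself can be added to `q` indefinitely.
    have hwN : ∀ c ∈ N, 0 ≤ c → w ⊓ c = 0 := by
      intro c hc hc0
      have hd0 : 0 ≤ w ⊓ c := le_inf hw0 hc0
      have hdN : w ⊓ c ∈ N := hN.mem_of_le hc hd0 inf_le_right
      have : ∀ n : ℕ, n • (w ⊓ c) ∈ N ∧ n • (w ⊓ c) ≤ x := by
        intro n
        induction n with
        | zero => simpa using ⟨h0, hx⟩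
        | succ n ih =>
          rw [succ_nsmul]
          refine ⟨hadd _ ih.1 _ hdN, ?_⟩
          have := hw (a := x - (n • (w ⊓ c) + 0)) ⟨_, 0, ih.1, nsmul_nonneg hd0 n, le_rfl,
            fun c _ hc => inf_eq_left.2 hc, by simpa using ih.2, rfl⟩
          rw [add_zero, le_sub_iff_add_le'] at this
          exact (add_le_add_right inf_le_left _).trans this
      exact hτ.eq_zero_of_forall_nsmul_le hd0 fun n => (this n).2
    refine hτ.eq_zero_of_forall_nsmul_le (y := x) hw0 fun n => ?_
    induction n with
    | zero => simpa using hx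
    | succ n ih =>
      have := hw (a := x - (0 + n • w)) ⟨0, _, h0, le_rfl, nsmul_nonneg hw0 n,
        fun c hc hc0 => nsmul_inf_eq_zero hw0 hc0 (hwN c hc hc0) n, by simpa using ih, rfl⟩
      rwa [zero_add, le_sub_iff_add_le', ← succ_nsmul] at this

/-- Upper bounds of a bounded sequence are topologically close to its finite suprema. -/
theorem IsLebesgue.exists_upperBound_sub_partialSups_mem (h : IsLebesgue τ)
    (hτ : IsLocallySolid τ) [T2Space X] {f : ℕ → X} (hf : ∀ n, 0 ≤ f n) {w : X}
    (hw : ∀ n, f n ≤ w) {V : Set X} (hV : V ∈ 𝓝 (0 : X)) :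
    ∃ (y : X) (j : ℕ), (∀ n, f n ≤ y) ∧ y - partialSups f j ∈ V := by
  let D : Set X := {d | ∃ (y : X) (j : ℕ), (∀ n, f n ≤ y) ∧ y - partialSups f j = d}
  have hD0 : ∀ d ∈ D, 0 ≤ d := by
    rintro d ⟨y, j, hy, rfl⟩
    exact sub_nonneg.2 (partialSups_le _ _ _ fun i _ => hy i)
  suffices hs : ∃ d ∈ D, d ∈ V by
    obtain ⟨d, ⟨y, j, hy, rfl⟩, hd⟩ := hs
    exact ⟨y, j, hy, hd⟩
  refine h.exists_mem_of_isGLB (D := D) ⟨_, w, 0, hw, rfl⟩ ?_ ⟨hD0, fun z hz => ?_⟩ hV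
  · rintro _ ⟨y, j, hy, rfl⟩ _ ⟨y', j', hy', rfl⟩
    exact ⟨_, ⟨y ⊓ y', max j j', fun n => le_inf (hy n) (hy' n), rfl⟩,
      sub_le_sub inf_le_left ((partialSups f).monotone (le_max_left _ _)),
      sub_le_sub inf_le_right ((partialSups f).monotone (le_max_right _ _))⟩
  · have ht : z ⊔ 0 ∈ lowerBounds D := fun d hd => sup_le (hz hd) (hD0 d hd)
    refine le_sup_left.trans (le_of_eq (?_ : z ⊔ 0 = 0))
    -- Subtracting the lower bound from an upper bound of `f` leaves an upper bound.
    have key : ∀ n : ℕ, ∀ i, f i ≤ w - n • (z ⊔ 0) := by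
      intro n
      induction n with
      | zero => simpa using hw
      | succ n ih =>
        intro i
        have := ht ⟨_, i, ih, rfl⟩
        rw [succ_nsmul, ← sub_sub, le_sub_comm]
        exact this.trans (sub_le_sub_left (le_partialSups f i) _)
    exact hτ.eq_zero_of_forall_nsmul_le (y := w) le_sup_right fun n =>
      sub_nonneg.1 ((hf 0).trans (key n 0))

/-- An element `z ≥ 0` below all eventual bounds of `q n ⊓ w` is disjoint from every `q k`, so it
can be subtracted from the bound `w` repeatedly. -/
theorem IsLebesgue.uoConverges_of_almost_disjoint (h : IsLebesgue τ) (hτ : IsLocallySolid τ)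
    [T2Space X] {V : ℕ → Set X} (hV : ∀ n, V n ∈ 𝓝 (0 : X))
    (hsol : ∀ n, LatticeOrderedAddCommGroup.IsSolid (V n))
    (hadd : ∀ n, ∀ a ∈ V (n + 1), ∀ b ∈ V (n + 1), a + b ∈ V n) {q : ℕ → X}
    (hq0 : ∀ n, 0 ≤ q n) (hqN : ∀ n, ∀ c ∈ ⋂ m, V m, 0 ≤ c → q n ⊓ c = 0)
    (hq : ∀ n, ∀ k < n, q n ⊓ q k ∈ V n) :
    UOConverges (fun a : ULift.{u} ℕ => q a.down) 0 := by
  intro w hw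
  have h0 : ∀ n, (0 : X) ∈ V n := fun n => mem_of_mem_nhds (hV n)
  have hanti : Antitone V :=
    antitone_nat_of_succ_le fun n a ha => by simpa using hadd n a ha 0 (h0 _)
  have hqw0 : ∀ n, 0 ≤ q n ⊓ w := fun n => le_inf (hq0 n) hw
  have habs : ∀ n, |(|q n - 0| ⊓ w)| = q n ⊓ w := fun n => by
    rw [sub_zero, abs_of_nonneg (hq0 n), abs_of_nonneg (hqw0 n)]
  refine OrderConverges.of_eventual_bounds ⟨w, ⟨0⟩, fun a _ => ?_⟩ fun z hz hzY => ?_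
  · rw [habs]
    exact inf_le_right
  replace hzY : ∀ y M, (∀ n, M ≤ n → q n ⊓ w ≤ y) → z ≤ y := fun y M hM =>
    hzY y ⟨⟨M⟩, fun a ha => by rw [habs]; exact hM _ ha⟩
  have hzq : ∀ k, z ⊓ q k = 0 := by
    intro k
    have hc0 : 0 ≤ z ⊓ q k := le_inf hz (hq0 k)
    suffices hc : z ⊓ q k ∈ ⋂ m, V m by
      rw [← hqN k _ hc hc0, inf_left_comm, inf_idem]
    -- `M ≥ k` puts the tail beyond `k`. Starting it at `M + 2` leaves one halving for the sum and
    -- one for the error `y - partialSups`.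
    refine mem_iInter.2 fun m => hanti (le_max_left m k) ?_
    set M := max m k
    obtain ⟨y, j, hy, hyj⟩ := h.exists_upperBound_sub_partialSups_mem hτ
      (f := fun i => q (M + 1 + 1 + i) ⊓ w) (fun n => hqw0 _) (w := w)
      (fun n => inf_le_right) (hV (M + 1))
    have hsum : ∑ i ∈ Finset.range (j + 1), (q (M + 1 + 1 + i) ⊓ w) ⊓ q k ∈ V (M + 1) := by
      refine sum_range_mem_of_add_mem h0 hadd _ _ _ fun i => ?_
      refine (hsol _).mem_of_le (hq (M + 1 + 1 + i) k ?_) (le_inf (hqw0 _) (hq0 k))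
        (inf_le_inf_right _ inf_le_left)
      have := le_max_right m k
      omega
    have hsup0 : 0 ≤ partialSups (fun i => q (M + 1 + 1 + i) ⊓ w) j :=
      (hqw0 (M + 1 + 1 + j)).trans (le_partialSups (fun i => q (M + 1 + 1 + i) ⊓ w) j)
    have hsub0 : 0 ≤ y - partialSups (fun i => q (M + 1 + 1 + i) ⊓ w) j :=
      sub_nonneg.2 (partialSups_le _ _ _ fun i _ => hy i)
    have hzy : z ≤ y := hzY y (M + 1 + 1) fun n hn => by
      obtain ⟨i, rfl⟩ := Nat.exists_eq_add_of_le hn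
      exact hy i
    refine (hsol M).mem_of_le (hadd M _ hyj _ hsum) hc0 ?_
    refine (inf_le_inf_right _ hzy).trans ?_
    have h2 := add_inf_le_inf_add_inf hsub0 hsup0 (hq0 k)
    rw [sub_add_cancel] at h2
    exact h2.trans (add_le_add inf_le_left (partialSups_inf_le_sum (fun n => hqw0 _) (hq0 k) j))
  have key : ∀ n : ℕ, ∀ i, q i ⊓ w ≤ w - n • z := by
    intro n
    induction n with
    | zero => simp
    | succ n ih =>
      intro i
      rw [succ_nsmul, ← sub_sub, le_sub_iff_add_le']
      exact add_le_of_inf_eq_zero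
        (eq_zero_of_le_inf_eq_zero (hzq i) hz (hqw0 i) le_rfl inf_le_left)
        (hzY _ 0 fun i _ => ih i) (ih i)
  exact hτ.eq_zero_of_forall_nsmul_le (y := w) hz fun n =>
    sub_nonneg.1 ((hqw0 0).trans (key n 0))

/-! ### From `uo`-Lebesgue to unbounded -/

omit [Module ℝ X] [IsOrderedModule ℝ X] in
theorem IsUOLebesgue.isLebesgue (h : IsUOLebesgue τ) : IsLebesgue τ :=
  fun A _ _ _ x hx => h A x (UOConverges.of_orderConverges_zero hx)

theorem IsUOLebesgue.exists_inf_mem_imp_mem (h : IsUOLebesgue τ) (hτ : IsLocallySolid τ)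
    [T2Space X] {U : Set X} (hU : U ∈ 𝓝 (0 : X)) :
    ∃ u : X, 0 ≤ u ∧ ∃ V ∈ 𝓝 (0 : X), ∀ x, |x| ⊓ u ∈ V → x ∈ U := by
  obtain ⟨V, hV, hsol, hadd, hVU⟩ := hτ.exists_seq hU
  have h0 : ∀ n, (0 : X) ∈ V n := fun n => mem_of_mem_nhds (hV n)
  by_contra! hcon
  have step : ∀ (u : X) (n : ℕ), ∃ q : X, 0 ≤ q ∧ (∀ c ∈ ⋂ m, V m, 0 ≤ c → q ⊓ c = 0) ∧
      q ∉ V 1 ∧ (0 ≤ u → q ⊓ u ∈ V n) := by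
    intro u n
    obtain ⟨x, hx, hxU⟩ := hcon (u ⊔ 0) le_sup_right (V n) (hV n)
    obtain ⟨p, q, hp, hp0, hq0, hq, hpq, hr⟩ := h.isLebesgue.exists_add_close hτ
      (N := ⋂ m, V m) (fun a ha b hab => mem_iInter.2 fun m => hsol m (mem_iInter.1 ha m) hab)
      (mem_iInter.2 h0)
      (fun a ha b hb => mem_iInter.2 fun m =>
        hadd m a (mem_iInter.1 ha _) b (mem_iInter.1 hb _))
      (abs_nonneg x) (hV 2)
    refine ⟨q, hq0, hq, fun hq1 => hxU (hVU ((hsol 0).abs_mem_iff.1 ?_)), fun hu => ?_⟩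
    -- If `q ∈ V 1`, then `p` and the remainder, both in `V 2`, would force `|x| ∈ V 0`.
    · have := hadd 0 _ hq1 _ (hadd 1 _ (mem_iInter.1 hp 2) _ hr)
      rwa [show q + (p + (|x| - (p + q))) = |x| by abel] at this
    · rw [sup_of_le_left hu] at hx
      exact (hsol n).mem_of_le hx (le_inf hq0 hu)
        (inf_le_inf_right _ ((le_add_of_nonneg_left hp0).trans hpq))
  choose g hg0 hgN hg1 hg using step
  -- The sum of the earlier terms dominates each of them, so one truncation controls all overlaps.
  let S : ℕ → X := fun n => Nat.rec 0 (fun n s => s + g s n) n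
  have hS : ∀ n, S (n + 1) = S n + g (S n) n := fun n => rfl
  have hSmono : Monotone S := monotone_nat_of_le_succ fun n => by
    rw [hS]
    exact le_add_of_nonneg_right (hg0 _ _)
  have hS0 : ∀ n, 0 ≤ S n := fun n => hSmono (Nat.zero_le n)
  have huo := h.isLebesgue.uoConverges_of_almost_disjoint hτ hV hsol hadd
    (q := fun n => g (S n) n) (fun n => hg0 _ _) (fun n => hgN _ _) fun n k hk => by
      refine (hsol n).mem_of_le (hg (S n) n (hS0 n)) (le_inf (hg0 _ _) (hg0 _ _))
        (inf_le_inf_left _ ?_)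
      calc g (S k) k ≤ S k + g (S k) k := le_add_of_nonneg_left (hS0 k)
        _ ≤ S n := hSmono hk
  obtain ⟨a, ha⟩ := ((h _ _ huo).eventually (hV 1)).exists
  exact hg1 _ _ ha

theorem IsUOLebesgue.isUnboundedTopology (h : IsUOLebesgue τ) (hτ : IsLocallySolid τ)
    [T2Space X] : IsUnboundedTopology τ := by
  refine TopologicalSpace.ext_nhds fun x => ?_
  rw [nhds_unboundedTopology τ hτ x]
  refine le_antisymm (le_iInf fun u => ?_) fun U hU => ?_
  · rw [← tendsto_iff_comap]
    intro U hU
    rw [mem_map]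
    obtain ⟨V, hV, hsol, hVU⟩ := hτ.solid_base U hU
    have ht : Tendsto (fun y : X => y + -x) (𝓝 x) (𝓝 0) := by
      have := (hτ.continuous_add.comp (by fun_prop : Continuous fun y : X => (y, -x))).tendsto x
      simpa [Function.comp_def] using this
    filter_upwards [ht hV] with y hy
    refine hVU (hsol hy ?_)
    rw [abs_of_nonneg (le_inf (abs_nonneg _) u.2), sub_eq_add_neg]
    exact inf_le_left
  · have ht : Tendsto (fun y : X => y + x) (𝓝 0) (𝓝 x) := by
      have := (hτ.continuous_add.comp (by fun_prop : Continuous fun y : X => (y, x))).tendsto 0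
      simpa [Function.comp_def] using this
    obtain ⟨u, hu, V, hV, hVU⟩ := h.exists_inf_mem_imp_mem hτ (ht hU)
    filter_upwards [mem_iInf_of_mem ⟨u, hu⟩ (preimage_mem_comap hV)] with y hy
    simpa using hVU (y - x) hy

end LocallySolid

theorem theorem5p9 {X : Type u} [AddCommGroup X] [Lattice X] [IsOrderedAddMonoid X]
    [Module ℝ X] [IsOrderedModule ℝ X] (τ : TopologicalSpace X) (hτ : IsLocallySolid τ)
    (hT2 : T2Space X) :
    IsUOLebesgue τ ↔ IsLebesgue τ ∧ IsUnboundedTopology τ := by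
  constructor
  · exact fun h => ⟨h.isLebesgue, h.isUnboundedTopology hτ⟩
  · rintro ⟨hL, hU⟩ A _ _ _ x hx
    have h := (tendsto_unboundedTopology_iff τ hτ atTop x 0).2 fun u hu => hL A _ (hx u hu)
    unfold IsUnboundedTopology at hU
    rwa [← hU] at h
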